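/- Let $X$ be a complex Banach space, $\mathbb B_r=\{x\in X:\|x\|<r\}$ and $\mathbb B=\mathbb B_1$. For $x\in X$ let $J(x)=\{x^*\in X^*:\langle x,x^*\rangle=\|x\|^2=\|x^*\|^2\}$, and for a bounded linear operator $A$ on $X$ and $\theta\in\mathbb R$ let $$K_A(\theta)=\sup\{\operatorname{Re}\,(e^{-i\theta}\langle Ax,x^*\rangle):\ \|x\|=1,\ x^*\in J(x)\}$$ (for $X=\{0\}$ put $K_A(\theta)=0$). Theorem. Let $h:\mathbb B\to X$ be holomorphic (that is, complex Fréchet differentiable) with $h(0)=0$, and let $A=h'(0)$. Assume that for some $\theta\in\mathbb R$ and $c\ge 0$ $$\operatorname{Re}\,\langle e^{-i\theta}h(x),x^*\rangle\le -c\|x\|^2\qquad\text{for all }x\in\mathbb B,\ x^*\in J(x).$$ Put $$\rho=\begin{cases} c, & K_A(\theta)>-3c,\\ \left(\sqrt{|2c+2K_A(\theta)|}-\sqrt{|2c+K_A(\theta)|}\right)^2, & K_A(\theta)\le -3c,\end{cases}$$ $$R=\begin{cases} 1, & K_A(\theta)>-3c,\\ \sqrt{\dfrac{2c+2K_A(\theta)}{2c+K_A(\theta)}}-1,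 & K_A(\theta)\le -3c.\end{cases}$$ Then the inverse mapping $h^{-1}$ is well defined and holomorphic on $\mathbb B_\rho$ and maps it biholomorphically into $\mathbb B_R$. That is, for every $y\in\mathbb B_\rho$ there is exactly one $x=:h^{-1}(y)\in\mathbb B_R$ with $h(x)=y$, the map $h^{-1}:\mathbb B_\rho\to\mathbb B_R$ is holomorphic, its image is open, and it has a holomorphic inverse on this image. (In the degenerate case $c=K_A(\theta)=0$, where the quotient defining $R$ is not defined, $\rho=0$, so $\mathbb B_\rho=\emptyset$ and nothing is asserted.) -/

import Mathlib

noncomputable section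

namespace HolInv

variable {X : Type*} [NormedAddCommGroup X] [NormedSpace ℂ X]

/-- The set `J(x)` of support functionals at `x`: bounded linear functionals `ℓ` with
`⟨x, ℓ⟩ = ‖x‖² = ‖ℓ‖²`. -/
def supportFunctionals (x : X) : Set (StrongDual ℂ X) :=
  {ℓ | ℓ x = ((‖x‖ ^ 2 : ℝ) : ℂ) ∧ ‖ℓ‖ ^ 2 = ‖x‖ ^ 2}

/-- The numerical range `V(A) = {⟨A x, ℓ⟩ : ‖x‖ = 1, ℓ ∈ J(x)}` of a bounded linear operator. -/
def numericalRange (A : X →L[ℂ] X) : Set ℂ :=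
  {w | ∃ x ∈ Metric.sphere (0 : X) 1, ∃ ℓ ∈ supportFunctionals x, w = ℓ (A x)}

/-- The support function `K_A(θ) = sup {Re (e^{-iθ} w) : w ∈ V(A)}` of the numerical range.
The set is bounded above by `‖A‖`, and it is non-empty unless `X` is the zero space. -/
def supportFun (A : X →L[ℂ] X) (θ : ℝ) : ℝ :=
  sSup ((fun w : ℂ => (Complex.exp (-(Complex.I * θ)) * w).re) '' numericalRange A)

/-- The radius `ρ` of the ball on which the inverse mapping lives (`K` stands for `K_A(θ)`). -/
def innerRadius (c K : ℝ) : ℝ :=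
  if K > -3 * c then c
  else (Real.sqrt |2 * c + 2 * K| - Real.sqrt |2 * c + K|) ^ 2

/-- The radius `R` of the ball that contains the values of the inverse mapping. When `K ≤ -3c`
and `0 ≤ c`, the denominator vanishes only for `c = K = 0`; then `innerRadius c K = 0`. -/
def outerRadius (c K : ℝ) : ℝ :=
  if K > -3 * c then 1
  else Real.sqrt ((2 * c + 2 * K) / (2 * c + K)) - 1

/-- `g` maps `D` biholomorphically into `D₁`: it is holomorphic on `D` with values in `D₁`, its
image `g(D)` is open, and it has a holomorphic inverse on `g(D)` (so `g` is injective on `D`). -/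
def IsBiholomorphicInto (g : X → X) (D D₁ : Set X) : Prop :=
  DifferentiableOn ℂ g D ∧ Set.MapsTo g D D₁ ∧ IsOpen (g '' D) ∧
    ∃ k : X → X, DifferentiableOn ℂ k (g '' D) ∧ Set.LeftInvOn k g D

end HolInv

end

open Metric Set Filter Topology

namespace HolInv

/-! ### Cauchy estimates and strict differentiability of holomorphic maps -/

section Holomorphic

variable {X : Type*} [NormedAddCommGroup X] [NormedSpace ℂ X]
variable {Y : Type*} [NormedAddCommGroup Y] [NormedSpace ℂ Y]

/-! Put `f = -e^{-iθ} h`, so that `Re ⟨f x, ℓ⟩ ≥ c‖x‖²`. Harnack's inequality on complex lines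
sharpens this to `Re ⟨f x, ℓ⟩ ≥ ‖x‖ φ(‖x‖)`, where `φ(r) = c r + (-K - c) r (1 - r)/(1 + r)`
(`re_apply_ge_of_numericalRange`). The radii satisfy `φ(R) = ρ` (`outerRadius_spec`), so for `‖w‖ <
ρ` the map `F = f - w` points strictly outwards in a shell just inside the sphere of radius `R`.

For small `l > 0` the map `x ↦ x - l F(x)` then sends a ball strictly inside itself. The
Earle–Hamilton theorem gives exactly one fixed point, which is the zero of `F`, and makes `F'`
invertible there (`exists_unique_zero`). The inverse function theorem, with uniqueness of the
preimage, makes the solution depend holomorphically on `w`.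

This argument needs `f` bounded on smaller balls, which is not automatic in infinite dimension.
Borel–Carathéodory bounds `⟨f x, ℓ⟩` for support functionals only. To pass to norms,
`norm_le_of_numericalRadius` bounds an entire map by its numerical radius; it is applied to each
homogeneous Taylor term and the series is summed (`exists_bound_of_accretive`). -/

/-- Cauchy estimate for the Fréchet derivative of a bounded holomorphic map. -/
theorem norm_fderiv_le_of_bounded {f : X → Y} {x : X} {r M : ℝ} (hr : 0 < r)
    (hf : DifferentiableOn ℂ f (ball x r)) (hM : ∀ z ∈ ball x r, ‖f z‖ ≤ M) :
    ‖fderiv ℂ f x‖ ≤ 2 * M / r := by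
  refine Complex.norm_fderiv_le_div_of_mapsTo_ball hf (fun z hz => ?_) hr
  rw [mem_closedBall, dist_eq_norm]
  have h1 := hM z hz
  have h2 := hM x (mem_ball_self hr)
  linarith [norm_sub_le (f z) (f x)]

/-- A bounded holomorphic map is Lipschitz on every smaller concentric ball. -/
theorem norm_sub_le_of_bounded {f : X → Y} {a : X} {r s M : ℝ} (hsr : s < r)
    (hf : DifferentiableOn ℂ f (ball a r)) (hM : ∀ z ∈ ball a r, ‖f z‖ ≤ M)
    {x y : X} (hx : x ∈ ball a s) (hy : y ∈ ball a s) :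
    ‖f x - f y‖ ≤ 2 * M / (r - s) * ‖x - y‖ := by
  have hsub : ∀ z ∈ ball a s, ball z (r - s) ⊆ ball a r := fun z hz =>
    ball_subset_ball' (by rw [mem_ball] at hz; linarith)
  refine (convex_ball a s).norm_image_sub_le_of_norm_fderiv_le (𝕜 := ℂ) (fun z hz => ?_)
    (fun z hz => ?_) hy hx
  · exact hf.differentiableAt (isOpen_ball.mem_nhds (ball_subset_ball hsr.le hz))
  · exact norm_fderiv_le_of_bounded (sub_pos.2 hsr) (hf.mono (hsub z hz))
      fun w hw => hM w (hsub z hz hw)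

/-- The derivative of a holomorphic map is continuous. -/
theorem continuousAt_fderiv_of_differentiableOn {f : X → Y} {U : Set X} (hU : IsOpen U)
    (hf : DifferentiableOn ℂ f U) {x : X} (hx : x ∈ U) : ContinuousAt (fderiv ℂ f) x := by
  have hc : ContinuousAt f x := (hf.differentiableAt (hU.mem_nhds hx)).continuousAt
  have hev : ∀ᶠ z in 𝓝 x, z ∈ U ∧ ‖f z‖ ≤ ‖f x‖ + 1 :=
    (hU.eventually_mem hx).and ((hc.norm.eventually_lt continuousAt_const (lt_add_one _)).mono
      fun _ h => h.le)
  obtain ⟨r, hr, hball⟩ := Metric.eventually_nhds_iff_ball.1 hev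
  set M := ‖f x‖ + 1
  have hM0 : 0 ≤ M := by positivity
  have hfr : DifferentiableOn ℂ f (ball x r) := hf.mono fun z hz => (hball z hz).1
  have hat : ∀ z ∈ ball x r, DifferentiableAt ℂ f z := fun z hz =>
    hfr.differentiableAt (isOpen_ball.mem_nhds hz)
  set L := 2 * M / (r - r / 2)
  rw [Metric.continuousAt_iff]
  intro ε hε
  have hL : 0 ≤ L := by
    have : 0 < r - r / 2 := by linarith
    positivity
  refine ⟨min (r / 4) (ε / (2 * L / (r / 4) + 1)), by positivity, fun {y} hy => ?_⟩
  rw [lt_min_iff] at hy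
  have hsub : ∀ z ∈ ball x (r / 4), z + (y - x) ∈ ball x (r / 2) := fun z hz => by
    rw [mem_ball, dist_eq_norm] at hz ⊢
    have h1 := hy.1
    rw [dist_eq_norm] at h1
    calc ‖z + (y - x) - x‖ = ‖(z - x) + (y - x)‖ := by congr 1; abel
      _ ≤ ‖z - x‖ + ‖y - x‖ := norm_add_le _ _
      _ < r / 2 := by linarith
  -- The difference of `f` and its translate is holomorphic and of size `L‖y - x‖`, so a Cauchy
  -- estimate bounds the difference of the derivatives.
  have hd : ∀ z ∈ ball x (r / 4), HasFDerivAt (fun w => f (w + (y - x)) - f w)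
      (fderiv ℂ f (z + (y - x)) - fderiv ℂ f z) z := fun z hz =>
    ((hasFDerivAt_comp_add_right _).2
      (hat _ (ball_subset_ball (by linarith) (hsub z hz))).hasFDerivAt).sub
      (hat z (ball_subset_ball (by linarith) hz)).hasFDerivAt
  have hb := norm_fderiv_le_of_bounded (M := L * ‖y - x‖) (by positivity : 0 < r / 4)
    (fun z hz => (hd z hz).differentiableAt.differentiableWithinAt) (fun z hz => by
      have := norm_sub_le_of_bounded (by linarith : r / 2 < r) hfr (fun z hz => (hball z hz).2)
        (hsub z hz) (ball_subset_ball (by linarith) hz)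
      simpa using this)
  rw [(hd x (mem_ball_self (by positivity))).fderiv, add_sub_cancel] at hb
  rw [dist_eq_norm]
  have h2 := hy.2
  rw [dist_eq_norm, lt_div_iff₀ (by positivity)] at h2
  calc _ ≤ _ := hb
    _ = ‖y - x‖ * (2 * L / (r / 4)) := by ring
    _ ≤ ‖y - x‖ * (2 * L / (r / 4) + 1) := by gcongr; linarith
    _ < ε := h2

theorem hasStrictFDerivAt_of_differentiableOn {f : X → Y} {U : Set X} (hU : IsOpen U)
    (hf : DifferentiableOn ℂ f U) {x : X} (hx : x ∈ U) :
    HasStrictFDerivAt f (fderiv ℂ f x) x :=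
  hasStrictFDerivAt_of_hasFDerivAt_of_continuousAt
    ((hU.eventually_mem hx).mono fun _ hy => (hf.differentiableAt (hU.mem_nhds hy)).hasFDerivAt)
    (continuousAt_fderiv_of_differentiableOn hU hf hx)

end Holomorphic

/-! ### The Earle–Hamilton theorem on balls -/

section EarleHamilton

variable {X : Type*} [NormedAddCommGroup X] [NormedSpace ℂ X]

/-- Let `p = G^[n] x`. Because `G` leaves room `r - r'`, the map `z ↦ G z + δ (G z - G p)` still
sends the ball into itself; at `p` it has the value of `G` but `1 + δ` times its derivative. The
bound for `n`, uniform in the self-map `g`, is applied to `g` composed with this map and gains the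
factor `(1 + δ)⁻¹`. The case `n = 0` is the Cauchy estimate. -/
theorem norm_fderiv_comp_iterate_le {G : X → X} {r r' : ℝ} (h0 : 0 ≤ r') (hr : r' < r)
    (hG : DifferentiableOn ℂ G (ball 0 r)) (hmaps : MapsTo G (ball 0 r) (closedBall 0 r'))
    (n : ℕ) {g : X → X} (hg : DifferentiableOn ℂ g (ball 0 r))
    (hgm : MapsTo g (ball 0 r) (ball 0 r)) {x : X} (hx : x ∈ ball (0 : X) r) :
    ‖fderiv ℂ (g ∘ G^[n]) x‖ ≤ (1 + (r - r') / (2 * r))⁻¹ ^ n * (2 * r / (r - ‖x‖)) := by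
  have hr0 : 0 < r := h0.trans_lt hr
  have hxr : ‖x‖ < r := by simpa using hx
  set δ := (r - r') / (2 * r)
  have hδ : 0 < δ := div_pos (sub_pos.2 hr) (by positivity)
  have hδr : 2 * δ * r' < r - r' := by
    have : 2 * δ * r' = (r - r') * (r' / r) := by simp only [δ]; field_simp
    rw [this]
    exact mul_lt_of_lt_one_right (sub_pos.2 hr) ((div_lt_one hr0).2 hr)
  have hmaps' : MapsTo G (ball 0 r) (ball 0 r) := hmaps.mono_right (closedBall_subset_ball hr)
  have hit : ∀ n, DifferentiableOn ℂ G^[n] (ball 0 r) := fun n => by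
    induction n with
    | zero => exact differentiableOn_id
    | succ n ih =>
      rw [Function.iterate_succ']
      exact hG.comp ih (hmaps'.iterate n)
  have hnhds : ∀ {z : X}, z ∈ ball (0 : X) r → ball (0 : X) r ∈ 𝓝 z := fun hz =>
    isOpen_ball.mem_nhds hz
  induction n generalizing g with
  | zero =>
    have hsub : ball x (r - ‖x‖) ⊆ ball 0 r := ball_subset_ball' (by simp)
    simpa using norm_fderiv_le_of_bounded (sub_pos.2 hxr) (hg.mono hsub)
      (M := r) fun z hz => (mem_ball_zero_iff.1 (hgm (hsub hz))).le
  | succ n ih =>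
    set p := G^[n] x
    have hp : p ∈ ball (0 : X) r := hmaps'.iterate n hx
    have hinner : ∀ z ∈ ball (0 : X) r, G z + (δ : ℂ) • (G z - G p) ∈ ball (0 : X) r :=
      fun z hz => by
      have h1 : ‖G z‖ ≤ r' := by simpa using hmaps hz
      have h2 : ‖G p‖ ≤ r' := by simpa using hmaps hp
      rw [mem_ball_zero_iff]
      calc ‖G z + (δ : ℂ) • (G z - G p)‖ ≤ ‖G z‖ + δ * (‖G z‖ + ‖G p‖) := by
            refine (norm_add_le _ _).trans ?_
            rw [norm_smul, Complex.norm_of_nonneg hδ.le]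
            gcongr
            exact norm_sub_le _ _
        _ ≤ r' + δ * (r' + r') := by gcongr
        _ < r := by linarith
    have hind : DifferentiableOn ℂ (fun z => G z + (δ : ℂ) • (G z - G p)) (ball 0 r) :=
      hG.add ((hG.sub_const _).const_smul _)
    have key := ih (hg.comp hind hinner) (hgm.comp hinner)
    have hDG := (hG.differentiableAt (hnhds hp)).hasFDerivAt
    have hDn := ((hit n).differentiableAt (hnhds hx)).hasFDerivAt
    have hDg := (hg.differentiableAt (hnhds (hmaps' hp))).hasFDerivAt
    have hDi : HasFDerivAt (fun z => G z + (δ : ℂ) • (G z - G p))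
        ((1 + δ : ℂ) • fderiv ℂ G p) p := by
      have := hDG.add ((hDG.sub_const (G p)).const_smul (δ : ℂ))
      rwa [← one_smul ℂ (fderiv ℂ G p), smul_smul, mul_one, ← add_smul] at this
    have hDg' : HasFDerivAt g (fderiv ℂ g (G p)) (G p + (δ : ℂ) • (G p - G p)) := by simpa using hDg
    have e1 : fderiv ℂ ((g ∘ fun z => G z + (δ : ℂ) • (G z - G p)) ∘ G^[n]) x =
        ((fderiv ℂ g (G p)) ∘L ((1 + δ : ℂ) • fderiv ℂ G p)) ∘L fderiv ℂ G^[n] x :=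
      (HasFDerivAt.comp x (HasFDerivAt.comp p hDg' hDi) hDn).fderiv
    have e2 : fderiv ℂ (g ∘ G^[n + 1]) x =
        ((fderiv ℂ g (G p)) ∘L fderiv ℂ G p) ∘L fderiv ℂ G^[n] x := by
      rw [Function.iterate_succ', ← Function.comp_assoc]
      exact (HasFDerivAt.comp x (HasFDerivAt.comp p hDg hDG) hDn).fderiv
    have e3 : ‖(1 + δ : ℂ)‖ = 1 + δ := by
      rw [← Complex.ofReal_one, ← Complex.ofReal_add, Complex.norm_of_nonneg (by positivity)]
    rw [e1, ContinuousLinearMap.comp_smul, ContinuousLinearMap.smul_comp, ← e2, norm_smul, e3,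
      ← le_inv_mul_iff₀ (by positivity)] at key
    rwa [pow_succ', mul_assoc]

/-- **Earle–Hamilton fixed point theorem** for balls, with invertibility of `1 - G'` at the
fixed point. -/
theorem exists_fixedPoint_of_mapsTo_closedBall [CompleteSpace X] {G : X → X} {r r' : ℝ}
    (h0 : 0 ≤ r') (hr : r' < r) (hG : DifferentiableOn ℂ G (ball 0 r))
    (hmaps : MapsTo G (ball 0 r) (closedBall 0 r')) :
    ∃ x ∈ ball (0 : X) r, G x = x ∧ IsUnit (1 - fderiv ℂ G x) ∧
      ∀ y ∈ ball (0 : X) r, G y = y → y = x := by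
  have hr0 : 0 < r := h0.trans_lt hr
  have hsub : closedBall (0 : X) r' ⊆ ball 0 r := closedBall_subset_ball hr
  have hq : (1 + (r - r') / (2 * r))⁻¹ < 1 := inv_lt_one_of_one_lt₀ (by
    have : 0 < (r - r') / (2 * r) := div_pos (sub_pos.2 hr) (by positivity)
    linarith)
  have hq0 : 0 ≤ (1 + (r - r') / (2 * r))⁻¹ := by
    have : 0 < (r - r') / (2 * r) := div_pos (sub_pos.2 hr) (by positivity)
    positivity
  obtain ⟨n, hn⟩ : ∃ n : ℕ, (1 + (r - r') / (2 * r))⁻¹ ^ n * (2 * r / (r - r')) ≤ 1 / 2 := by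
    have ht := (tendsto_pow_atTop_nhds_zero_of_lt_one hq0 hq).mul_const (2 * r / (r - r'))
    rw [zero_mul] at ht
    exact (ht.eventually_le_const (by norm_num)).exists
  have hit : ∀ n, DifferentiableOn ℂ G^[n] (ball 0 r) := fun n => by
    induction n with
    | zero => exact differentiableOn_id
    | succ n ih =>
      rw [Function.iterate_succ']
      exact hG.comp ih ((hmaps.mono_right hsub).iterate n)
  have hD : ∀ x ∈ closedBall (0 : X) r', ‖fderiv ℂ G^[n] x‖ ≤ 1 / 2 := fun x hx => by
    refine (norm_fderiv_comp_iterate_le h0 hr hG hmaps n differentiableOn_id (mapsTo_id _)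
      (hsub hx)).trans (le_trans ?_ hn)
    have : ‖x‖ ≤ r' := by simpa using hx
    have := sub_pos.2 hr
    gcongr
  have hcontr : ∀ x ∈ closedBall (0 : X) r', ∀ y ∈ closedBall (0 : X) r',
      ‖G^[n] y - G^[n] x‖ ≤ 1 / 2 * ‖y - x‖ := fun x hx y hy =>
    (convex_closedBall (0 : X) r').norm_image_sub_le_of_norm_fderiv_le (𝕜 := ℂ)
      (fun z hz => (hit n).differentiableAt (isOpen_ball.mem_nhds (hsub hz))) hD hx hy
  have huniq : ∀ x ∈ closedBall (0 : X) r', ∀ y ∈ closedBall (0 : X) r',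
      G^[n] x = x → G^[n] y = y → y = x := fun x hx y hy ex ey => by
    have := hcontr x hx y hy
    rw [ex, ey] at this
    rw [← sub_eq_zero, ← norm_le_zero_iff]
    linarith
  have hms : MapsTo G^[n] (closedBall (0 : X) r') (closedBall 0 r') :=
    (hmaps.mono_left hsub).iterate n
  have hcw : ContractingWith (1 / 2) (hms.restrict G^[n] _ _) := by
    refine ⟨by norm_num, LipschitzWith.of_dist_le_mul fun x y => ?_⟩
    have := hcontr y y.2 x x.2
    simpa [Subtype.dist_eq, dist_eq_norm] using this
  obtain ⟨x, hx, hfix, -⟩ := hcw.exists_fixedPoint' isClosed_closedBall.isComplete hms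
    (mem_closedBall_self h0) (edist_ne_top _ _)
  -- `G x` is also fixed by the contraction `G^[n]`, so it equals `x`.
  have hGx : G x = x := huniq x hx (G x) (hmaps (hsub hx)) hfix (by
    rw [← Function.iterate_succ_apply, Function.iterate_succ_apply', hfix])
  refine ⟨x, hsub hx, hGx, ?_, fun y hy hGy => ?_⟩
  · have hd := ((hG.differentiableAt (isOpen_ball.mem_nhds (hsub hx))).hasFDerivAt.iterate
      hGx n).fderiv
    have hlt : ‖fderiv ℂ G x ^ n‖ < 1 := by
      rw [← hd]
      exact (hD x hx).trans_lt (by norm_num)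
    have hu := isUnit_one_sub_of_norm_lt_one hlt
    -- `1 - D ^ n` is a unit and factors as `1 - D` times a commuting geometric sum.
    rw [← mul_neg_geom_sum] at hu
    refine ((Commute.isUnit_mul_iff ?_).1 hu).1
    rw [Commute, SemiconjBy, mul_neg_geom_sum, geom_sum_mul_neg]
  · exact huniq x hx y (by rw [← hGy]; exact hmaps hy) hfix (Function.IsFixedPt.iterate hGy n)

end EarleHamilton

/-! ### Support functionals and zeros of outward-pointing maps -/

section Support

variable {X : Type*} [NormedAddCommGroup X] [NormedSpace ℂ X]

theorem norm_eq_of_mem_supportFunctionals {x : X} {ℓ : StrongDual ℂ X}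
    (h : ℓ ∈ supportFunctionals x) : ‖ℓ‖ = ‖x‖ :=
  (sq_eq_sq₀ (norm_nonneg _) (norm_nonneg _)).1 h.2

theorem re_apply_self_of_mem_supportFunctionals {x : X} {ℓ : StrongDual ℂ X}
    (h : ℓ ∈ supportFunctionals x) : (ℓ x).re = ‖x‖ ^ 2 := by
  rw [h.1, Complex.ofReal_re]

theorem norm_apply_le_of_mem_supportFunctionals {x : X} {ℓ : StrongDual ℂ X}
    (h : ℓ ∈ supportFunctionals x) (y : X) : ‖ℓ y‖ ≤ ‖x‖ * ‖y‖ :=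
  norm_eq_of_mem_supportFunctionals h ▸ ℓ.le_opNorm y

theorem re_apply_le_of_mem_supportFunctionals {x : X} {ℓ : StrongDual ℂ X}
    (h : ℓ ∈ supportFunctionals x) (y : X) : (ℓ y).re ≤ ‖x‖ * ‖y‖ :=
  (Complex.re_le_norm _).trans (norm_apply_le_of_mem_supportFunctionals h y)

theorem smul_mem_supportFunctionals {x : X} {ℓ : StrongDual ℂ X}
    (h : ℓ ∈ supportFunctionals x) (z : ℂ) :
    (starRingEnd ℂ z) • ℓ ∈ supportFunctionals (z • x) := by
  refine ⟨?_, ?_⟩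
  · simp only [smul_apply, map_smul, smul_eq_mul, h.1, norm_smul, mul_pow]
    rw [← mul_assoc, Complex.mul_conj, Complex.normSq_eq_norm_sq]
    push_cast
    rfl
  · rw [norm_smul, norm_smul, norm_eq_of_mem_supportFunctionals h, RCLike.norm_conj]

theorem supportFunctionals_nonempty (x : X) : (supportFunctionals x).Nonempty := by
  rcases eq_or_ne x 0 with rfl | hx
  · exact ⟨0, by simp [supportFunctionals]⟩
  · obtain ⟨g, hg, hgx⟩ := exists_dual_vector ℂ x (norm_ne_zero_iff.2 hx)
    refine ⟨((‖x‖ : ℝ) : ℂ) • g, ?_, ?_⟩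
    · rw [smul_apply, hgx, smul_eq_mul]
      push_cast
      exact (sq _).symm
    · rw [norm_smul, hg, mul_one, Complex.norm_of_nonneg (norm_nonneg _)]

/-- Moving from `x` to `z` against a support functional at `z` decreases the norm. -/
theorem norm_le_sub_of_supportFunctional {x z : X} {ℓ : StrongDual ℂ X} {a : ℝ}
    (h : ℓ ∈ supportFunctionals z) (hz : z ≠ 0) (ha : a * ‖z‖ ≤ (ℓ (x - z)).re) :
    ‖z‖ ≤ ‖x‖ - a := by
  have h1 := re_apply_le_of_mem_supportFunctionals h x
  have h2 := re_apply_self_of_mem_supportFunctionals h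
  rw [map_sub, Complex.sub_re, h2] at ha
  have hz' : 0 < ‖z‖ := norm_pos_iff.2 hz
  have : ‖z‖ * ‖z‖ ≤ ‖z‖ * (‖x‖ - a) := by nlinarith
  exact le_of_mul_le_mul_left this hz'

/-- A bounded holomorphic map pointing strictly outwards near a sphere has exactly one zero
inside, and its derivative there is invertible. -/
theorem exists_unique_zero [CompleteSpace X] {F : X → X} {r₀ r r₁ M ε : ℝ} (h0 : 0 ≤ r₀)
    (h01 : r₀ < r) (h12 : r < r₁) (hε : 0 < ε) (hF : DifferentiableOn ℂ F (ball 0 r₁))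
    (hM : ∀ x ∈ ball (0 : X) r₁, ‖F x‖ ≤ M)
    (hpos : ∀ x : X, r₀ ≤ ‖x‖ → ‖x‖ < r₁ → ∀ ℓ ∈ supportFunctionals x,
      ε * ‖x‖ ≤ (ℓ (F x)).re) :
    ∃ x ∈ ball (0 : X) r, F x = 0 ∧ IsUnit (fderiv ℂ F x) ∧
      ∀ y ∈ ball (0 : X) r, F y = 0 → y = x := by
  have hM0 : 0 ≤ M := (norm_nonneg _).trans (hM 0 (mem_ball_self (by linarith)))
  set s := (r + r₁) / 2
  have hs1 : s < r₁ := by simp only [s]; linarith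
  have hrs : r < s := by simp only [s]; linarith
  set L := 2 * M / (r₁ - s)
  have hL0 : 0 ≤ L := div_nonneg (by positivity) (by linarith)
  have hLip : ∀ x ∈ ball (0 : X) s, ∀ y ∈ ball (0 : X) s, ‖F x - F y‖ ≤ L * ‖x - y‖ :=
    fun x hx y hy => norm_sub_le_of_bounded hs1 hF hM hx hy
  -- The first bound keeps `x - l F(x)` in the ball of radius `s`, where `F` is Lipschitz; by the
  -- second, replacing `F (G x)` by `F x` costs at most half of `ε`.
  obtain ⟨l, hl, hl1, hl2⟩ : ∃ l : ℝ, 0 < l ∧ l * M < s - r ∧ l * (L * M) ≤ ε / 2 := by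
    refine ⟨min ((s - r) / (M + 1)) (ε / 2 / (L * M + 1)), ?_, ?_, ?_⟩
    · have := sub_pos.2 hrs
      positivity
    · have : min ((s - r) / (M + 1)) (ε / 2 / (L * M + 1)) * (M + 1) ≤ s - r := by
        rw [← le_div_iff₀ (by positivity)]
        exact min_le_left _ _
      have h3 : 0 < min ((s - r) / (M + 1)) (ε / 2 / (L * M + 1)) := by
        have := sub_pos.2 hrs
        positivity
      linarith
    · have : min ((s - r) / (M + 1)) (ε / 2 / (L * M + 1)) * (L * M + 1) ≤ ε / 2 := by
        rw [← le_div_iff₀ (by positivity)]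
        exact min_le_right _ _
      have h3 : 0 < min ((s - r) / (M + 1)) (ε / 2 / (L * M + 1)) := by
        have := sub_pos.2 hrs
        positivity
      linarith
  set G : X → X := fun x => x - (l : ℂ) • F x
  have hr1 : ball (0 : X) r ⊆ ball 0 r₁ := ball_subset_ball h12.le
  have hGd : ∀ x ∈ ball (0 : X) r₁,
      HasFDerivAt G (1 - (l : ℂ) • fderiv ℂ F x) x := fun x hx =>
    (hasFDerivAt_id x).sub
      ((hF.differentiableAt (isOpen_ball.mem_nhds hx)).hasFDerivAt.const_smul _)
  -- The support functional is taken at the new point `G x`, not at `x`, so the norm decrease is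
  -- exact and needs no smoothness of the norm. The other two entries of the maximum cover `‖G x‖ ≤
  -- r₀` and `G x = 0`.
  have hmaps : MapsTo G (ball 0 r) (closedBall 0 (max r₀ (max 0 (r - l * ε / 2)))) := fun x hx => by
    rw [mem_closedBall_zero_iff, le_max_iff]
    rcases le_total ‖G x‖ r₀ with h | h
    · exact Or.inl h
    right
    have hxr : ‖x‖ < r := by simpa using hx
    rcases eq_or_ne (G x) 0 with hz | hz
    · simp [hz]
    refine le_max_of_le_right ?_
    have hFx : ‖F x‖ ≤ M := hM x (hr1 hx)
    have hdist : ‖x - G x‖ ≤ l * M := by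
      simp only [G, sub_sub_cancel, norm_smul, Complex.norm_of_nonneg hl.le]
      gcongr
    have hGs : ‖G x‖ < s := by
      have := norm_le_norm_add_norm_sub' (G x) x
      rw [norm_sub_rev (G x)] at this
      linarith
    obtain ⟨ℓ, hℓ⟩ := supportFunctionals_nonempty (G x)
    have hlow := hpos (G x) h (hGs.trans hs1) ℓ hℓ
    have hdiff : (ℓ (F (G x) - F x)).re ≤ ‖G x‖ * (L * (l * M)) := by
      refine (re_apply_le_of_mem_supportFunctionals hℓ _).trans ?_
      gcongr
      refine (hLip _ (by simpa using hGs) _ (ball_subset_ball hrs.le hx)).trans ?_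
      rw [norm_sub_rev]
      gcongr
    have hkey := norm_le_sub_of_supportFunctional (x := x) (a := l * ε / 2) hℓ hz (by
      have e : x - G x = (l : ℂ) • F x := by simp [G]
      rw [e, map_smul, smul_eq_mul, Complex.re_ofReal_mul]
      rw [map_sub, Complex.sub_re] at hdiff
      have h5 : ε / 2 * ‖G x‖ ≤ (ℓ (F x)).re := by
        have := mul_le_mul_of_nonneg_left hl2 (norm_nonneg (G x))
        nlinarith
      calc l * ε / 2 * ‖G x‖ = l * (ε / 2 * ‖G x‖) := by ring
        _ ≤ _ := by gcongr)
    linarith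
  obtain ⟨x, hx, hfix, hunit, huniq⟩ := exists_fixedPoint_of_mapsTo_closedBall
    (h0.trans (le_max_left _ _)) (max_lt h01 (max_lt (h0.trans_lt h01) (sub_lt_self r (by positivity)))) (G := G)
    (fun x hx => (hGd x (hr1 hx)).differentiableAt.differentiableWithinAt) hmaps
  have hl' : (l : ℂ) ≠ 0 := by exact_mod_cast hl.ne'
  refine ⟨x, hx, ?_, ?_, fun y hy hFy => huniq y hy (by simp [G, hFy])⟩
  · simpa [G, hl.ne'] using hfix
  · rw [(hGd x (hr1 hx)).fderiv, sub_sub_cancel] at hunit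
    have := hunit.smul (Units.mk0 (l : ℂ) hl')⁻¹
    rwa [Units.smul_def, smul_smul, Units.val_inv_eq_inv_val, Units.val_mk0,
      inv_mul_cancel₀ hl', one_smul] at this

end Support

/-! ### Harnack's inequality on the disc -/

section Harnack

/-- The Cayley transform `w` of `p` vanishes at `0` and has modulus at most `1`, so Schwarz's lemma
gives `‖w z‖ ≤ ‖z‖`. The imaginary parts enter with weight `1 - ‖z‖² ≥ 0` and can be dropped. -/
theorem harnack_of_re_pos {p : ℂ → ℂ} (hp : DifferentiableOn ℂ p (ball 0 1))
    (hpos : ∀ z ∈ ball (0 : ℂ) 1, 0 < (p z).re) {z : ℂ} (hz : z ∈ ball (0 : ℂ) 1) :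
    (p 0).re * ((1 - ‖z‖) / (1 + ‖z‖)) ≤ (p z).re := by
  have h0 : (0 : ℂ) ∈ ball (0 : ℂ) 1 := mem_ball_self one_pos
  set w : ℂ → ℂ := fun z => (p z - p 0) / (p z + starRingEnd ℂ (p 0))
  have hne : ∀ z ∈ ball (0 : ℂ) 1, p z + starRingEnd ℂ (p 0) ≠ 0 := fun z hz h => by
    have := congrArg Complex.re h
    simp only [Complex.add_re, Complex.conj_re, Complex.zero_re] at this
    linarith [hpos z hz, hpos 0 h0]
  have hwd : DifferentiableOn ℂ w (ball 0 1) := (hp.sub_const _).div (hp.add_const _) hne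
  have hsq : ∀ a : ℂ, ‖a‖ ^ 2 = a.re ^ 2 + a.im ^ 2 := fun a => by
    rw [← Complex.normSq_eq_norm_sq, Complex.normSq_apply]; ring
  have hwm : MapsTo w (ball 0 1) (closedBall 0 1) := fun z hz => by
    rw [mem_closedBall_zero_iff, norm_div, div_le_one (norm_pos_iff.2 (hne z hz)),
      ← sq_le_sq₀ (norm_nonneg _) (norm_nonneg _), hsq, hsq]
    simp only [Complex.sub_re, Complex.sub_im, Complex.add_re, Complex.add_im, Complex.conj_re,
      Complex.conj_im]
    nlinarith [hpos z hz, hpos 0 h0, mul_pos (hpos z hz) (hpos 0 h0)]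
  have hz1 : ‖z‖ < 1 := by simpa using hz
  have hw := Complex.norm_le_norm_of_mapsTo_ball hwd hwm (by simp [w]) hz1
  rw [norm_div, div_le_iff₀ (norm_pos_iff.2 (hne z hz)),
    ← sq_le_sq₀ (norm_nonneg _) (by positivity), mul_pow, hsq (p z - p 0),
    hsq (p z + starRingEnd ℂ (p 0))] at hw
  simp only [Complex.sub_re, Complex.sub_im, Complex.add_re, Complex.add_im, Complex.conj_re,
    Complex.conj_im] at hw
  have ht : ‖z‖ ^ 2 ≤ 1 := pow_le_one₀ (norm_nonneg _) hz1.le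
  have h2 : ((p z).re - (p 0).re) ^ 2 ≤ (‖z‖ * ((p z).re + (p 0).re)) ^ 2 := by
    nlinarith [mul_nonneg (sub_nonneg.2 ht) (sq_nonneg ((p z).im - (p 0).im))]
  have h3 := abs_le_of_sq_le_sq h2
    (mul_nonneg (norm_nonneg _) (add_pos (hpos z hz) (hpos 0 h0)).le)
  rw [← mul_div_assoc, div_le_iff₀ (by positivity)]
  linarith [(abs_le.1 h3).1]

/-- **Harnack's inequality** on the unit disc for a half-plane `c ≤ Re`. -/
theorem harnack_of_le_re {p : ℂ → ℂ} {c : ℝ} (hp : DifferentiableOn ℂ p (ball 0 1))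
    (hpos : ∀ z ∈ ball (0 : ℂ) 1, c ≤ (p z).re) {z : ℂ} (hz : z ∈ ball (0 : ℂ) 1) :
    c + ((p 0).re - c) * ((1 - ‖z‖) / (1 + ‖z‖)) ≤ (p z).re := by
  have hz1 : ‖z‖ < 1 := by simpa using hz
  have hq : (1 - ‖z‖) / (1 + ‖z‖) ≥ 0 := div_nonneg (by linarith) (by positivity)
  refine le_of_forall_pos_le_add fun ε hε => ?_
  have := harnack_of_re_pos (p := fun z => p z + ((ε - c : ℝ) : ℂ)) (hp.add_const _)
    (fun z hz => by
      rw [Complex.add_re, Complex.ofReal_re]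
      linarith [hpos z hz]) hz
  simp only [Complex.add_re, Complex.ofReal_re] at this
  nlinarith [mul_nonneg hε.le hq]

end Harnack

/-! ### Restriction to complex lines through the origin -/

section Slices

variable {X : Type*} [NormedAddCommGroup X] [NormedSpace ℂ X]

/-- On a complex line through the origin, `⟨f (z u), ℓ⟩ / z` is holomorphic with real part at least
`c`. -/
theorem exists_slice {f : X → X} {c : ℝ} (hf : DifferentiableOn ℂ f (ball 0 1)) (h0 : f 0 = 0)
    (hpos : ∀ x ∈ ball (0 : X) 1, ∀ ℓ ∈ supportFunctionals x, c * ‖x‖ ^ 2 ≤ (ℓ (f x)).re)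
    {u : X} (hu : ‖u‖ = 1) {ℓ : StrongDual ℂ X} (hℓ : ℓ ∈ supportFunctionals u) :
    ∃ p : ℂ → ℂ, DifferentiableOn ℂ p (ball 0 1) ∧ p 0 = ℓ (fderiv ℂ f 0 u) ∧
      (∀ z : ℂ, z * p z = ℓ (f (z • u))) ∧ ∀ z ∈ ball (0 : ℂ) 1, c ≤ (p z).re := by
  have hmem : ∀ {z : ℂ}, z ∈ ball (0 : ℂ) 1 → z • u ∈ ball (0 : X) 1 := fun {z} hz => by
    simpa [norm_smul, hu] using hz
  set g : ℂ → ℂ := fun z => ℓ (f (z • u))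
  have hgd : DifferentiableOn ℂ g (ball 0 1) := ℓ.differentiable.comp_differentiableOn
    (hf.comp (differentiable_id.smul_const u).differentiableOn fun z hz => hmem hz)
  have hpd : DifferentiableOn ℂ (dslope g 0) (ball 0 1) :=
    (Complex.differentiableOn_dslope (ball_mem_nhds _ one_pos)).2 hgd
  have hzp : ∀ z : ℂ, z * dslope g 0 z = g z := fun z => by
    have := sub_smul_dslope g 0 z
    simpa [g, h0] using this
  -- The functional `conj z • ℓ` supports `z • u`, and its value on `f (z • u)` is `‖z‖²` times the
  -- slope. The point `z = 0` follows by continuity.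
  have hc : ∀ z ∈ ball (0 : ℂ) 1, z ≠ 0 → c ≤ (dslope g 0 z).re := fun z hz hz0 => by
    have h1 := hpos _ (hmem hz) _ (smul_mem_supportFunctionals hℓ z)
    have h2 : 0 < ‖z‖ ^ 2 := by positivity
    have h3 : (starRingEnd ℂ z • ℓ) (f (z • u)) = ((‖z‖ ^ 2 : ℝ) : ℂ) * dslope g 0 z := by
      rw [smul_apply, smul_eq_mul, show ℓ (f (z • u)) = _ from (hzp z).symm, ← mul_assoc, mul_comm _ z, Complex.mul_conj,
        Complex.normSq_eq_norm_sq]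
    rw [h3, Complex.re_ofReal_mul, norm_smul, hu, mul_one, mul_comm] at h1
    exact le_of_mul_le_mul_left h1 h2
  refine ⟨dslope g 0, hpd, ?_, hzp, fun z hz => ?_⟩
  · rw [dslope_same]
    have hfd : HasFDerivAt f (fderiv ℂ f 0) ((0 : ℂ) • u) := by
      rw [zero_smul]
      exact (hf.differentiableAt (ball_mem_nhds _ one_pos)).hasFDerivAt
    have := (ℓ.hasFDerivAt.comp_hasDerivAt (0 : ℂ)
      (hfd.comp_hasDerivAt (0 : ℂ) ((hasDerivAt_id (0 : ℂ)).smul_const u))).deriv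
    simpa [g, Function.comp_def] using this
  · rcases eq_or_ne z 0 with rfl | hz0
    · have hcont : Tendsto (fun z => (dslope g 0 z).re) (𝓝[≠] 0) (𝓝 (dslope g 0 0).re) :=
        (Complex.continuous_re.continuousAt.comp
          (hpd.differentiableAt (ball_mem_nhds _ one_pos)).continuousAt).mono_left
          nhdsWithin_le_nhds
      refine ge_of_tendsto hcont ?_
      filter_upwards [self_mem_nhdsWithin, nhdsWithin_le_nhds (ball_mem_nhds (0 : ℂ) one_pos)]
        with z h1 h2 using hc z h2 h1
    · exact hc z hz hz0

theorem exists_normalized_support {x : X} (hx : x ≠ 0) {ℓ : StrongDual ℂ X}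
    (hℓ : ℓ ∈ supportFunctionals x) :
    ∃ u : X, ∃ ℓ' ∈ supportFunctionals u, ‖u‖ = 1 ∧ x = (‖x‖ : ℂ) • u ∧ ℓ = (‖x‖ : ℂ) • ℓ' := by
  have hx' : (‖x‖ : ℂ) ≠ 0 := by exact_mod_cast norm_ne_zero_iff.2 hx
  refine ⟨(‖x‖ : ℂ)⁻¹ • x, _, smul_mem_supportFunctionals hℓ _, ?_, ?_, ?_⟩
  · rw [norm_smul, norm_inv, Complex.norm_of_nonneg (norm_nonneg x),
      inv_mul_cancel₀ (norm_ne_zero_iff.2 hx)]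
  · rw [smul_smul, mul_inv_cancel₀ hx', one_smul]
  · rw [map_inv₀, Complex.conj_ofReal, smul_smul, mul_inv_cancel₀ hx', one_smul]

/-- Sharp lower bound for `Re ⟨f x, ℓ⟩` in terms of a lower bound `m` for the real part of the
numerical range of `f'(0)`. -/
theorem re_apply_ge_of_numericalRange {f : X → X} {c m : ℝ}
    (hf : DifferentiableOn ℂ f (ball 0 1)) (h0 : f 0 = 0)
    (hpos : ∀ x ∈ ball (0 : X) 1, ∀ ℓ ∈ supportFunctionals x, c * ‖x‖ ^ 2 ≤ (ℓ (f x)).re)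
    (hm : ∀ u : X, ‖u‖ = 1 → ∀ ℓ ∈ supportFunctionals u, m ≤ (ℓ (fderiv ℂ f 0 u)).re)
    {x : X} (hx : x ∈ ball (0 : X) 1) {ℓ : StrongDual ℂ X} (hℓ : ℓ ∈ supportFunctionals x) :
    ‖x‖ ^ 2 * (c + (m - c) * ((1 - ‖x‖) / (1 + ‖x‖))) ≤ (ℓ (f x)).re := by
  rcases eq_or_ne x 0 with rfl | hx0
  · simp [h0]
  obtain ⟨u, ℓ', hℓ', hu, hxu, hℓu⟩ := exists_normalized_support hx0 hℓ
  obtain ⟨p, hpd, hp0, hzp, hpc⟩ := exists_slice hf h0 hpos hu hℓ'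
  have hx1 : ‖x‖ < 1 := by simpa using hx
  have hnx : ‖(‖x‖ : ℂ)‖ = ‖x‖ := Complex.norm_of_nonneg (norm_nonneg x)
  have hz : (‖x‖ : ℂ) ∈ ball (0 : ℂ) 1 := by rwa [mem_ball_zero_iff, hnx]
  have hH := harnack_of_le_re hpd hpc hz
  rw [hnx, hp0] at hH
  have e : ℓ (f x) = ((‖x‖ ^ 2 : ℝ) : ℂ) * p ‖x‖ := by
    have : ℓ (f x) = (‖x‖ : ℂ) * ℓ' (f ((‖x‖ : ℂ) • u)) := by
      rw [← hxu]
      nth_rewrite 1 [hℓu]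
      rfl
    rw [this, ← hzp]
    push_cast
    ring
  rw [e, Complex.re_ofReal_mul]
  have hq : (1 - ‖x‖) / (1 + ‖x‖) ≥ 0 := div_nonneg (by linarith) (by positivity)
  refine mul_le_mul_of_nonneg_left (le_trans ?_ hH) (by positivity)
  have := hm u hu ℓ' hℓ'
  gcongr

/-- The numerical range of `f` is bounded on smaller balls. -/
theorem norm_apply_le_of_accretive {f : X → X} {c : ℝ} (hc : 0 ≤ c)
    (hf : DifferentiableOn ℂ f (ball 0 1)) (h0 : f 0 = 0)
    (hpos : ∀ x ∈ ball (0 : X) 1, ∀ ℓ ∈ supportFunctionals x, c * ‖x‖ ^ 2 ≤ (ℓ (f x)).re)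
    {u : X} (hu : ‖u‖ = 1) {ℓ : StrongDual ℂ X} (hℓ : ℓ ∈ supportFunctionals u) {z : ℂ}
    (hz : z ∈ ball (0 : ℂ) 1) :
    ‖ℓ (f (z • u))‖ ≤ (2 + 2 * ‖fderiv ℂ f 0‖) / (1 - ‖z‖) := by
  obtain ⟨p, hpd, hp0, hzp, hpc⟩ := exists_slice hf h0 hpos hu hℓ
  have hz1 : ‖z‖ < 1 := by simpa using hz
  -- `Re (-p) ≤ -c ≤ 0`; the bound used is `1` because a positive one is required.
  have hB := Complex.borelCaratheodory (f := fun z => -p z) one_pos hpd.neg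
    (fun z hz => by
      simp only [mem_ofPred_eq, Complex.neg_re]
      linarith [hpc z hz]) one_pos hz
  simp only [norm_neg, hp0] at hB
  have hp : ‖ℓ (fderiv ℂ f 0 u)‖ ≤ ‖fderiv ℂ f 0‖ := by
    have h1 := norm_apply_le_of_mem_supportFunctionals hℓ (fderiv ℂ f 0 u)
    have h2 := (fderiv ℂ f 0).le_opNorm u
    rw [hu] at h1 h2
    linarith
  rw [← hzp, norm_mul]
  have h1z : 0 < 1 - ‖z‖ := by linarith
  calc ‖z‖ * ‖p z‖ ≤ 1 * ‖p z‖ := by gcongr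
    _ ≤ 2 * 1 * ‖z‖ / (1 - ‖z‖) + ‖ℓ (fderiv ℂ f 0 u)‖ * (1 + ‖z‖) / (1 - ‖z‖) := by
      rw [one_mul]; exact hB
    _ ≤ 2 * 1 * 1 / (1 - ‖z‖) + ‖fderiv ℂ f 0‖ * (1 + 1) / (1 - ‖z‖) := by gcongr
    _ = _ := by ring

end Slices

/-! ### Bounding a map by its numerical radius -/

section NumericalRadius

variable {X : Type*} [NormedAddCommGroup X] [NormedSpace ℂ X]

/-- One explicit Euler step increases the norm at most by the numerical radius, up to second
order. -/
theorem norm_euler_step_le {Q : X → X} {v M L κ : ℝ} (hM : ∀ x, ‖x‖ ≤ 1 → ‖Q x‖ ≤ M)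
    (hL : ∀ x y, ‖x‖ ≤ 1 → ‖y‖ ≤ 1 → ‖Q x - Q y‖ ≤ L * ‖x - y‖) (hL0 : 0 ≤ L) (hκ : 0 ≤ κ)
    (hnum : ∀ x, ‖x‖ ≤ 1 → ∀ ℓ ∈ supportFunctionals x, ‖ℓ (Q x)‖ ≤ v * ‖x‖) (hv : 0 ≤ v)
    {a : X} (ha : ‖a‖ + κ * M ≤ 1) {μ : ℂ} (hμ : ‖μ‖ ≤ κ) :
    ‖a + μ • Q a‖ ≤ ‖a‖ + κ * (v + L * M * κ) := by
  have hM0 : 0 ≤ M := (norm_nonneg _).trans (hM 0 (by simp))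
  have ha1 : ‖a‖ ≤ 1 := by nlinarith [mul_nonneg hκ hM0]
  set z := a + μ • Q a
  rcases eq_or_ne z 0 with hz | hz
  · rw [hz, norm_zero]; positivity
  have hd : ‖z - a‖ ≤ κ * M := by
    simp only [z, add_sub_cancel_left, norm_smul]
    gcongr
    exact hM a ha1
  have hz1 : ‖z‖ ≤ 1 := by linarith [norm_le_norm_add_norm_sub' z a]
  obtain ⟨ℓ, hℓ⟩ := supportFunctionals_nonempty z
  -- The functional supports the end point `z`, so `Q a` is compared with `Q z`; this is the
  -- second-order error.
  have h1 : ‖ℓ (Q a)‖ ≤ (v + L * M * κ) * ‖z‖ := by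
    have h2 := norm_apply_le_of_mem_supportFunctionals hℓ (Q z - Q a)
    have h3 : ‖Q z - Q a‖ ≤ L * (κ * M) :=
      (hL z a hz1 ha1).trans (mul_le_mul_of_nonneg_left hd hL0)
    have h4 := hnum z hz1 ℓ hℓ
    have h5 := mul_le_mul_of_nonneg_left h3 (norm_nonneg z)
    rw [map_sub] at h2
    have h6 := norm_le_norm_add_norm_sub (ℓ (Q z)) (ℓ (Q a))
    linarith
  have := norm_le_sub_of_supportFunctional (x := a) (a := -(κ * (v + L * M * κ))) hℓ hz (by
    have e : a - z = -(μ • Q a) := by simp [z]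
    rw [e, map_neg, map_smul, Complex.neg_re, neg_mul, neg_le_neg_iff]
    calc (μ • ℓ (Q a)).re ≤ ‖μ • ℓ (Q a)‖ := Complex.re_le_norm _
      _ = ‖μ‖ * ‖ℓ (Q a)‖ := norm_smul _ _
      _ ≤ κ * ((v + L * M * κ) * ‖z‖) := by gcongr
      _ = _ := by ring)
  linarith

/-- Euler steps of complex size `t / N` replace the flow of `Q`: they are entire in `t`, and `N` of
them have derivative `Q x` at `t = 0`. A Cauchy estimate in `t` then bounds `Q x`. -/
theorem hasDerivAt_euler_iterate {Q : X → X} (hQ : Differentiable ℂ Q) (N : ℂ) (x : X) (k : ℕ) :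
    Differentiable ℂ (fun t : ℂ => (fun y => y + (t / N) • Q y)^[k] x) ∧
      HasDerivAt (fun t : ℂ => (fun y => y + (t / N) • Q y)^[k] x) ((k / N : ℂ) • Q x) 0 := by
  induction k with
  | zero =>
    simp only [Function.iterate_zero, id, Nat.cast_zero, zero_div, zero_smul]
    exact ⟨differentiable_const x, hasDerivAt_const _ _⟩
  | succ k ih =>
    obtain ⟨ihd, ihD⟩ := ih
    simp only [Function.iterate_succ_apply']
    refine ⟨ihd.add ((differentiable_id.div_const N).smul (hQ.comp ihd)), ?_⟩
    have hQd := (hQ.comp ihd 0).hasDerivAt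
    have := ihD.add (((hasDerivAt_id (0 : ℂ)).div_const N).smul hQd)
    have hfix : ∀ k : ℕ, (fun y => y + ((0 : ℂ) / N) • Q y)^[k] x = x := fun k => by
      induction k with
      | zero => rfl
      | succ k ih => rw [Function.iterate_succ_apply', ih]; simp
    have hv : (Q ∘ fun t : ℂ => (fun y => y + (t / N) • Q y)^[k] x) 0 = Q x :=
      congrArg Q (hfix k)
    rw [hv] at this
    refine this.congr_deriv ?_
    simp only [id, zero_div, zero_smul, zero_add]
    rw [← add_smul]
    push_cast
    rw [add_div]

/-- The norm of an entire map that is bounded on bounded sets is controlled by its numerical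
radius. -/
theorem norm_le_of_numericalRadius {Q : X → X} {v M : ℝ} (hQ : Differentiable ℂ Q)
    (hM : ∀ x ∈ ball (0 : X) 3, ‖Q x‖ ≤ M) (hv : 0 < v)
    (hnum : ∀ x, ‖x‖ ≤ 1 → ∀ ℓ ∈ supportFunctionals x, ‖ℓ (Q x)‖ ≤ v * ‖x‖)
    {x : X} (hx : ‖x‖ < 1) : ‖Q x‖ ≤ 2 * v / (1 - ‖x‖) := by
  have hM0 : 0 ≤ M := (norm_nonneg _).trans (hM 0 (mem_ball_self (by norm_num)))
  set s := ‖x‖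
  set L := 2 * M / (3 - 2)
  have hL0 : 0 ≤ L := by positivity
  have hL : ∀ x y : X, ‖x‖ ≤ 1 → ‖y‖ ≤ 1 → ‖Q x - Q y‖ ≤ L * ‖x - y‖ := fun x y hx hy =>
    norm_sub_le_of_bounded (by norm_num) hQ.differentiableOn hM
      (mem_ball_zero_iff.2 (by linarith)) (mem_ball_zero_iff.2 (by linarith))
  have h1s : 0 < 1 - s := by linarith
  -- Of the room `1 - s` up to the unit sphere, half is spent on first-order growth `τ v`, a quarter
  -- on the accumulated error and a quarter on the length `κ M` of one step. The result is `1 / τ`.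
  set τ := (1 - s) / (2 * v)
  have hτ : 0 < τ := by positivity
  have hτv : τ * v = (1 - s) / 2 := by simp only [τ]; field_simp
  obtain ⟨N, hN, hN0⟩ : ∃ N : ℕ, (τ * (L * M) + M) * (τ / N) ≤ (1 - s) / 4 ∧ 0 < N := by
    have ht : Tendsto (fun N : ℕ => (τ * (L * M) + M) * (τ / N)) atTop (𝓝 0) := by
      simpa using (tendsto_const_div_atTop_nhds_zero_nat τ).const_mul (τ * (L * M) + M)
    exact ((ht.eventually_le_const (by positivity)).and (eventually_gt_atTop 0)).exists
  set κ := τ / N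
  have hN0' : (0 : ℝ) < N := by exact_mod_cast hN0
  have hκ : 0 < κ := by positivity
  have hNκ : N * κ = τ := by simp only [κ]; field_simp
  have hκ1 : τ * (L * M * κ) ≤ (1 - s) / 4 := by
    nlinarith [mul_nonneg hM0 hκ.le]
  have hκ2 : κ * M ≤ (1 - s) / 4 := by
    have : 0 ≤ τ * (L * M) * κ := by positivity
    nlinarith
  have hstep : ∀ t : ℂ, ‖t‖ ≤ τ → ∀ k ≤ N,
      ‖(fun y => y + (t / N) • Q y)^[k] x‖ ≤ s + k * (κ * (v + L * M * κ)) := fun t ht k => by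
    have hμ : ‖t / (N : ℂ)‖ ≤ κ := by
      rw [norm_div, Complex.norm_natCast]
      exact div_le_div_of_nonneg_right ht hN0'.le
    induction k with
    | zero => intro _; simp [s]
    | succ k ih =>
      intro hk
      have ihk := ih (by lia)
      rw [Function.iterate_succ_apply']
      have hkN : (k : ℝ) ≤ N := by exact_mod_cast (by lia : k ≤ N)
      have hkb : k * (κ * (v + L * M * κ)) ≤ (1 - s) / 2 + (1 - s) / 4 := by
        calc k * (κ * (v + L * M * κ)) ≤ N * (κ * (v + L * M * κ)) := by gcongr
          _ = τ * v + τ * (L * M * κ) := by rw [← hNκ]; ring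
          _ ≤ _ := by linarith
      have := norm_euler_step_le (fun x hx => hM x (mem_ball_zero_iff.2 (by linarith))) hL hL0 hκ.le
        hnum hv.le (by linarith) hμ (a := (fun y => y + (t / N) • Q y)^[k] x)
      push_cast
      linarith
  obtain ⟨hdiff, hder⟩ := hasDerivAt_euler_iterate hQ N x N
  have hC := Complex.norm_deriv_le_of_forall_mem_sphere_norm_le hτ (c := 0) (C := 1)
    hdiff.diffContOnCl (fun t ht => by
      have := hstep t (by simpa using (mem_sphere_zero_iff_norm.1 ht).le) N le_rfl
      have e : N * (κ * (v + L * M * κ)) = τ * v + τ * (L * M * κ) := by rw [← hNκ]; ring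
      linarith)
  rw [hder.deriv, div_self (by exact_mod_cast hN0.ne'), one_smul] at hC
  calc ‖Q x‖ ≤ 1 / τ := hC
    _ = _ := by simp only [τ]; field_simp

end NumericalRadius

/-! ### Homogeneous Taylor terms -/

section TaylorCoeff

variable {X : Type*} [NormedAddCommGroup X] [NormedSpace ℂ X]
variable {Y : Type*} [NormedAddCommGroup Y] [NormedSpace ℂ Y]

/-- The `n`-th homogeneous term of the Taylor expansion of `f` at the origin. -/
noncomputable def taylorTerm (f : X → Y) (n : ℕ) (x : X) : Y :=
  (n.factorial : ℂ)⁻¹ • iteratedDeriv n (fun ζ : ℂ => f (ζ • x)) 0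

theorem taylorTerm_smul (f : X → Y) (n : ℕ) (a : ℂ) (x : X) :
    taylorTerm f n (a • x) = a ^ n • taylorTerm f n x := by
  have h : ∀ n : ℕ, iteratedDeriv n (fun ζ : ℂ => f (ζ • a • x)) =
      fun ζ => a ^ n • iteratedDeriv n (fun ζ : ℂ => f (ζ • x)) (a * ζ) := fun n => by
    induction n with
    | zero =>
      funext ζ
      simp [smul_smul, mul_comm]
    | succ n ih =>
      funext ζ
      rw [iteratedDeriv_succ, ih, iteratedDeriv_succ]
      have e : deriv (fun ζ => a ^ n • iteratedDeriv n (fun ζ : ℂ => f (ζ • x)) (a * ζ)) ζ =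
          a ^ n • deriv (fun ζ => iteratedDeriv n (fun ζ : ℂ => f (ζ • x)) (a * ζ)) ζ :=
        deriv_fun_const_smul_field _ _
      rw [e, deriv_comp_mul_left, smul_smul, pow_succ]
  simp only [taylorTerm, h, mul_zero]
  rw [smul_comm]

theorem differentiableOn_slice {f : X → Y} (hf : DifferentiableOn ℂ f (ball 0 1)) {x : X} {r : ℝ}
    (hr : r * ‖x‖ ≤ 1) : DifferentiableOn ℂ (fun ζ : ℂ => f (ζ • x)) (ball 0 r) := by
  rcases eq_or_ne x 0 with rfl | hx
  · simp only [smul_zero]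
    exact differentiableOn_const _
  refine hf.comp (differentiable_id.smul_const x).differentiableOn fun ζ hζ => ?_
  have h1 : ‖ζ‖ < r := by simpa using hζ
  rw [mem_ball_zero_iff, norm_smul]
  exact (mul_lt_mul_of_pos_right h1 (norm_pos_iff.2 hx)).trans_le hr

theorem hasSum_taylorTerm [CompleteSpace Y] {f : X → Y} (hf : DifferentiableOn ℂ f (ball 0 1))
    {x : X} (hx : ‖x‖ < 1) : HasSum (fun n => taylorTerm f n x) (f x) := by
  have hr : (2 / (1 + ‖x‖)) * ‖x‖ ≤ 1 := by
    rw [div_mul_eq_mul_div, div_le_one (by positivity)]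
    linarith
  have := Complex.hasSum_taylorSeries_on_ball (differentiableOn_slice hf hr) (z := 1) (by
    rw [mem_ball_zero_iff, norm_one, one_lt_div (by positivity)]
    linarith)
  simpa [taylorTerm] using this

theorem diffContOnCl_slice {f : X → Y} (hf : DifferentiableOn ℂ f (ball 0 1)) {x : X} {s : ℝ}
    (hs : 0 < s) (hx : s * ‖x‖ < 1) : DiffContOnCl ℂ (fun ζ : ℂ => f (ζ • x)) (ball 0 s) := by
  have h2 : (2 * s / (1 + s * ‖x‖)) * ‖x‖ ≤ 1 := by
    rw [div_mul_eq_mul_div, div_le_one (by positivity)]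
    linarith
  refine (differentiableOn_slice hf h2).diffContOnCl_ball (closedBall_subset_ball ?_)
  rw [lt_div_iff₀ (by positivity)]
  nlinarith

theorem norm_taylorTerm_le [CompleteSpace Y] {f : X → Y} (hf : DifferentiableOn ℂ f (ball 0 1))
    {x : X} {s C : ℝ} (hs : 0 < s) (hx : s * ‖x‖ < 1)
    (hC : ∀ ζ : ℂ, ‖ζ‖ = s → ‖f (ζ • x)‖ ≤ C) (n : ℕ) : ‖taylorTerm f n x‖ ≤ C / s ^ n := by
  have := Complex.norm_iteratedDeriv_le_of_forall_mem_sphere_norm_le n hs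
    (diffContOnCl_slice hf hs hx) fun ζ hζ => hC ζ (mem_sphere_zero_iff_norm.1 hζ)
  have hn : (0 : ℝ) < n.factorial := by exact_mod_cast n.factorial_pos
  rw [taylorTerm, norm_smul, norm_inv, Complex.norm_natCast, inv_mul_le_iff₀ hn]
  exact this.trans_eq (mul_div_assoc _ _ _)

/-- On a fixed circle `x` is a mere parameter, which allows differentiation in `x` under the
integral. -/
theorem taylorTerm_eq_circleIntegral [CompleteSpace Y] {f : X → Y}
    (hf : DifferentiableOn ℂ f (ball 0 1)) {x : X} (hx : ‖x‖ < 1) (n : ℕ) :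
    taylorTerm f n x = (2 * Real.pi * Complex.I : ℂ)⁻¹ •
      ∮ ζ in C(0, 1), (ζ - 0)⁻¹ ^ (n + 1) • f (ζ • x) := by
  have h := DiffContOnCl.circleIntegral_one_div_sub_center_pow_smul one_pos n
    (diffContOnCl_slice hf one_pos (by simpa using hx) (x := x))
  have hn : (n.factorial : ℂ) ≠ 0 := by exact_mod_cast n.factorial_ne_zero
  simp only [one_div, ← inv_pow] at h
  rw [h, smul_smul, taylorTerm]
  congr 1
  have : (2 * Real.pi * Complex.I : ℂ) ≠ 0 := by simp [Real.pi_ne_zero]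
  field_simp

theorem clm_taylorTerm [CompleteSpace Y] {Z : Type*} [NormedAddCommGroup Z] [NormedSpace ℂ Z]
    {f : X → Y}
    (hf : DifferentiableOn ℂ f (ball 0 1)) (ℓ : Y →L[ℂ] Z) (n : ℕ) (x : X) :
    ℓ (taylorTerm f n x) = taylorTerm (fun y => ℓ (f y)) n x := by
  have hr : (1 / (1 + ‖x‖)) * ‖x‖ ≤ 1 := by
    rw [div_mul_eq_mul_div, div_le_one (by positivity)]
    linarith
  have ha : ContDiffAt ℂ n (fun ζ : ℂ => f (ζ • x)) 0 :=
    ((differentiableOn_slice hf hr).analyticAt (ball_mem_nhds _ (by positivity))).contDiffAt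
  rw [taylorTerm, taylorTerm, map_smul, iteratedDeriv_eq_iteratedFDeriv,
    iteratedDeriv_eq_iteratedFDeriv]
  have := ℓ.iteratedFDeriv_comp_left ha (i := n) le_rfl
  rw [Function.comp_def] at this
  rw [this]
  rfl

theorem differentiableAt_circleIntegral_smul [CompleteSpace Y] {f : X → Y} {δ M : ℝ} (hδ : 0 < δ)
    (hf : DifferentiableOn ℂ f (ball 0 δ)) (hM : ∀ x ∈ ball (0 : X) δ, ‖f x‖ ≤ M) (n : ℕ) {x : X}
    (hx : x ∈ ball (0 : X) (δ / 2)) :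
    DifferentiableAt ℂ (fun y => ∮ ζ in C(0, 1), (ζ - 0)⁻¹ ^ (n + 1) • f (ζ • y)) x := by
  set w : ℝ → ℂ := circleMap 0 1
  have hw : ∀ θ, ‖w θ‖ = 1 := fun θ => by simp [w]
  have hwc : Continuous w := continuous_circleMap 0 1
  set k : ℝ → ℂ := fun θ => deriv (circleMap 0 1) θ * (w θ - 0)⁻¹ ^ (n + 1)
  have hk : ∀ θ, ‖k θ‖ = 1 := fun θ => by simp [k, w]
  have hkc : Continuous k := by
    refine Continuous.mul ?_ (((hwc.sub continuous_const).inv₀ fun θ h => ?_).pow _)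
    · rw [funext (deriv_circleMap 0 1)]
      exact hwc.mul continuous_const
    · have := hw θ
      rw [show w θ = 0 by simpa using h, norm_zero] at this
      exact zero_ne_one this
  have hmem : ∀ θ, ∀ {r : ℝ} {y : X}, y ∈ ball (0 : X) r → w θ • y ∈ ball (0 : X) r :=
    fun θ r y hy => by
      rw [mem_ball_zero_iff] at hy ⊢
      rwa [norm_smul, hw, one_mul]
  have hsub : ball (0 : X) (δ / 2) ⊆ ball 0 δ := ball_subset_ball (by linarith)
  have hFc : ∀ y ∈ ball (0 : X) (δ / 2), Continuous fun θ => k θ • f (w θ • y) := fun y hy =>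
    hkc.smul (hf.continuousOn.comp_continuous (hwc.smul continuous_const)
      fun θ => hsub (hmem θ hy))
  have hfd : ContinuousOn (fderiv ℂ f) (ball 0 δ) := fun z hz =>
    (continuousAt_fderiv_of_differentiableOn isOpen_ball hf hz).continuousWithinAt
  have hmain := intervalIntegral.hasFDerivAt_integral_of_dominated_of_fderiv_le
    (μ := MeasureTheory.volume) (a := 0) (b := 2 * Real.pi) (x₀ := x) (𝕜 := ℂ)
    (F := fun y θ => k θ • f (w θ • y))
    (F' := fun y θ => k θ • w θ • fderiv ℂ f (w θ • y))
    (bound := fun _ => 2 * M / (δ / 2)) (isOpen_ball.mem_nhds hx)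
    ((isOpen_ball.eventually_mem hx).mono fun y hy => (hFc y hy).aestronglyMeasurable)
    ((hFc x hx).intervalIntegrable _ _)
    (hkc.smul (hwc.smul (hfd.comp_continuous (hwc.smul continuous_const)
      fun θ => hsub (hmem θ hx)))).aestronglyMeasurable
    (.of_forall fun θ _ y hy => by
      rw [norm_smul, norm_smul, hw, hk, one_mul, one_mul]
      have hy' : ‖w θ • y‖ < δ / 2 := by simpa using hmem θ hy
      have hs : ball (w θ • y) (δ / 2) ⊆ ball 0 δ := ball_subset_ball' (by
        rw [dist_zero_right]; linarith)
      exact norm_fderiv_le_of_bounded (by positivity) (hf.mono hs) fun z hz => hM z (hs hz))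
    intervalIntegrable_const
    (.of_forall fun θ _ y hy => by
      have h1 := (hf.differentiableAt (isOpen_ball.mem_nhds (hsub (hmem θ hy)))).hasFDerivAt
      have h2 : HasFDerivAt (fun y : X => w θ • y) (w θ • ContinuousLinearMap.id ℂ X) y :=
        (hasFDerivAt_id y).const_smul (w θ)
      have h3 := (h1.comp y h2).const_smul (k θ)
      rwa [ContinuousLinearMap.comp_smul, ContinuousLinearMap.comp_id] at h3)
  refine (hmain.differentiableAt).congr_of_eventuallyEq (.of_forall fun y => ?_)
  simp only [circleIntegral, smul_smul, k, w]

/-- The Taylor terms of a holomorphic map are entire and bounded on bounded sets. -/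
theorem differentiable_taylorTerm [CompleteSpace Y] {f : X → Y}
    (hf : DifferentiableOn ℂ f (ball 0 1)) (n : ℕ) :
    Differentiable ℂ (taylorTerm f n) ∧
      ∀ r > 0, ∃ M, ∀ x ∈ ball (0 : X) r, ‖taylorTerm f n x‖ ≤ M := by
  have hc : ContinuousAt f 0 := (hf.differentiableAt (ball_mem_nhds _ one_pos)).continuousAt
  have hev : ∀ᶠ z in 𝓝 (0 : X), z ∈ ball (0 : X) 1 ∧ ‖f z‖ ≤ ‖f 0‖ + 1 :=
    (isOpen_ball.eventually_mem (mem_ball_self one_pos)).and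
      ((hc.norm.eventually_lt continuousAt_const (lt_add_one _)).mono fun _ h => h.le)
  obtain ⟨δ, hδ, hball⟩ := Metric.eventually_nhds_iff_ball.1 hev
  -- `f` is known to be bounded only near `0`; homogeneity carries what holds there to all of `X`.
  have hscale : ∀ {a : ℂ}, a ≠ 0 → ∀ x, taylorTerm f n x = (a ^ n)⁻¹ • taylorTerm f n (a • x) :=
    fun {a} ha x => by
      rw [taylorTerm_smul, smul_smul, inv_mul_cancel₀ (pow_ne_zero _ ha), one_smul]
  have hloc : ∀ x ∈ ball (0 : X) (δ / 2), DifferentiableAt ℂ (taylorTerm f n) x := fun x hx => by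
    refine ((differentiableAt_circleIntegral_smul hδ (hf.mono fun z hz => (hball z hz).1)
      (fun z hz => (hball z hz).2) n hx).const_smul
      (2 * Real.pi * Complex.I : ℂ)⁻¹).congr_of_eventuallyEq ?_
    filter_upwards [isOpen_ball.eventually_mem hx] with y hy
    exact taylorTerm_eq_circleIntegral hf (mem_ball_zero_iff.1
      (hball y (ball_subset_ball (by linarith) hy)).1) n
  constructor
  · intro x
    have ha : ((δ / 2 / (‖x‖ + 1) : ℝ) : ℂ) ≠ 0 := by
      exact_mod_cast (by positivity : δ / 2 / (‖x‖ + 1) ≠ 0)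
    rw [funext (hscale ha)]
    refine DifferentiableAt.const_smul ?_ _
    refine DifferentiableAt.comp (g := taylorTerm f n) x (hloc _ ?_) (differentiableAt_id.const_smul _)
    rw [mem_ball_zero_iff, norm_smul, Complex.norm_of_nonneg (by positivity),
      div_mul_eq_mul_div, div_lt_iff₀ (by positivity)]
    gcongr
    exact lt_add_one _
  · intro r hr
    have ha : ((δ / r : ℝ) : ℂ) ≠ 0 := by exact_mod_cast (by positivity : δ / r ≠ 0)
    refine ⟨‖((δ / r : ℝ) : ℂ) ^ n‖⁻¹ * (‖f 0‖ + 1), fun x hx => ?_⟩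
    have hmem : ((δ / r : ℝ) : ℂ) • x ∈ ball (0 : X) δ := by
      rw [mem_ball_zero_iff] at hx ⊢
      rw [norm_smul, Complex.norm_of_nonneg (by positivity), div_mul_eq_mul_div,
        div_lt_iff₀ hr]
      gcongr
    rw [hscale ha x, norm_smul, norm_inv]
    gcongr
    have h1 := norm_taylorTerm_le hf one_pos (by
      simpa using (hball _ hmem).1) (x := ((δ / r : ℝ) : ℂ) • x) (C := ‖f 0‖ + 1)
      (fun ζ hζ => (hball _ (by
        rw [mem_ball_zero_iff] at hmem ⊢
        rwa [norm_smul, hζ, one_mul])).2) n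
    simpa using h1

end TaylorCoeff

/-! ### Boundedness on smaller balls -/

section Bounded

variable {X : Type*} [NormedAddCommGroup X] [NormedSpace ℂ X]

/-- A holomorphic map on the unit ball whose numerical range lies in a half-plane is bounded on
smaller balls. -/
theorem exists_bound_of_accretive [CompleteSpace X] {f : X → X} {c : ℝ} (hc : 0 ≤ c)
    (hf : DifferentiableOn ℂ f (ball 0 1)) (h0 : f 0 = 0)
    (hpos : ∀ x ∈ ball (0 : X) 1, ∀ ℓ ∈ supportFunctionals x, c * ‖x‖ ^ 2 ≤ (ℓ (f x)).re)
    {r : ℝ} (hr0 : 0 < r) (hr1 : r < 1) : ∃ M, ∀ x ∈ ball (0 : X) r, ‖f x‖ ≤ M := by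
  -- One factor `s` is lost in the Cauchy estimate on a slice, the other in rescaling the `r`-ball
  -- to the `s`-ball; the terms decay like `(r / s²) ^ n`.
  obtain ⟨s, hs0, hs1, hrs⟩ : ∃ s : ℝ, 0 < s ∧ s < 1 ∧ r < s * s :=
    ⟨(1 + r) / 2, by linarith, by linarith, by nlinarith [sq_pos_of_pos (sub_pos.2 hr1)]⟩
  set C := (2 + 2 * ‖fderiv ℂ f 0‖) / (1 - s)
  have h1s : 0 < 1 - s := by linarith
  have hC : 0 < C := by positivity
  have hnum : ∀ n : ℕ, ∀ x : X, ‖x‖ ≤ 1 → ∀ ℓ ∈ supportFunctionals x,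
      ‖ℓ (taylorTerm f n x)‖ ≤ C / s ^ n * ‖x‖ := fun n x hx ℓ hℓ => by
    rcases eq_or_ne x 0 with rfl | hx0
    · rw [norm_zero, mul_zero]
      refine (norm_apply_le_of_mem_supportFunctionals hℓ _).trans ?_
      simp
    obtain ⟨u, ℓ', hℓ', hu, hxu, hℓu⟩ := exists_normalized_support hx0 hℓ
    have h1 : ‖ℓ' (taylorTerm f n u)‖ ≤ C / s ^ n := by
      rw [clm_taylorTerm hf]
      refine norm_taylorTerm_le (ℓ'.differentiable.comp_differentiableOn hf) hs0
        (by rwa [hu, mul_one]) (fun ζ hζ => ?_) n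
      have := norm_apply_le_of_accretive hc hf h0 hpos hu hℓ' (z := ζ) (by
        rw [mem_ball_zero_iff, hζ]; exact hs1)
      rwa [hζ] at this
    have h2 : ℓ (taylorTerm f n x) = (‖x‖ : ℂ) * ((‖x‖ : ℂ) ^ n * ℓ' (taylorTerm f n u)) := by
      have : ℓ (taylorTerm f n x) = (‖x‖ : ℂ) * ℓ' (taylorTerm f n ((‖x‖ : ℂ) • u)) := by
        rw [← hxu]
        nth_rewrite 1 [hℓu]
        rfl
      rw [this, taylorTerm_smul, map_smul, smul_eq_mul]
    rw [h2, norm_mul, norm_mul, norm_pow, Complex.norm_of_nonneg (norm_nonneg x), mul_comm]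
    gcongr
    calc ‖x‖ ^ n * ‖ℓ' (taylorTerm f n u)‖ ≤ 1 * ‖ℓ' (taylorTerm f n u)‖ := by
          gcongr
          exact pow_le_one₀ (norm_nonneg _) hx
      _ ≤ _ := by rwa [one_mul]
  have hterm : ∀ x ∈ ball (0 : X) r, ∀ n : ℕ,
      ‖taylorTerm f n x‖ ≤ 2 * C / (1 - s) * (r / (s * s)) ^ n := fun x hx n => by
    obtain ⟨hd, hb⟩ := differentiable_taylorTerm hf n
    obtain ⟨M, hM⟩ := hb 3 (by norm_num)
    have hb0 : ((s / r : ℝ) : ℂ) ≠ 0 := by exact_mod_cast (by positivity : s / r ≠ 0)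
    have hnb : ‖((s / r : ℝ) : ℂ)‖ = s / r := Complex.norm_of_nonneg (by positivity)
    have hy : ‖((s / r : ℝ) : ℂ) • x‖ ≤ s := by
      have hx' : ‖x‖ < r := by simpa using hx
      rw [norm_smul, hnb, div_mul_eq_mul_div, div_le_iff₀ hr0]
      gcongr
    have h1 := norm_le_of_numericalRadius hd hM (by positivity) (hnum n) (hy.trans_lt hs1)
    rw [taylorTerm_smul, norm_smul, norm_pow, hnb] at h1
    have h2 : 2 * (C / s ^ n) / (1 - ‖((s / r : ℝ) : ℂ) • x‖) ≤ 2 * (C / s ^ n) / (1 - s) := by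
      gcongr
    have h3 := h1.trans h2
    rw [← le_div_iff₀' (by positivity)] at h3
    refine h3.trans_eq ?_
    rw [div_pow, div_pow, mul_pow]
    field_simp
  have hq : r / (s * s) < 1 := (div_lt_one (by positivity)).2 hrs
  have hgeo := (hasSum_geometric_of_lt_one (by positivity) hq).mul_left (2 * C / (1 - s))
  refine ⟨2 * C / (1 - s) * (1 - r / (s * s))⁻¹, fun x hx => ?_⟩
  rw [← (hasSum_taylorTerm hf ((mem_ball_zero_iff.1 hx).trans hr1)).tsum_eq]
  exact tsum_of_norm_bounded hgeo (hterm x hx)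

end Bounded

/-! ### The radii, solvability and the inverse map -/

section Inverse

variable {X : Type*} [NormedAddCommGroup X] [NormedSpace ℂ X]

/-- The left side is `φ(R)`. When `-K ≥ c`, `R` is chosen to maximise `φ` on `[0, 1]`: at the
endpoint `1` if `K > -3c`, otherwise at the critical point `a / b - 1`. In the second case `c = a²/2
- b²` and `-K - c = a²/2`, so the value is `(a - b)²`. -/
theorem outerRadius_spec {c K : ℝ} (hc : 0 ≤ c) (hρ : 0 < innerRadius c K) :
    0 < outerRadius c K ∧ outerRadius c K ≤ 1 ∧
      c * outerRadius c K + (-K - c) *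
        (outerRadius c K * ((1 - outerRadius c K) / (1 + outerRadius c K))) = innerRadius c K := by
  unfold outerRadius
  unfold innerRadius at hρ ⊢
  by_cases hK : K > -3 * c
  · simp only [if_pos hK]
    norm_num
  rw [if_neg hK] at hρ
  simp only [if_neg hK]
  push Not at hK
  have hK0 : K < 0 := by
    by_contra h
    have hc0 : c = 0 := by linarith
    have hK0 : K = 0 := by linarith
    simp [hc0, hK0] at hρ
  set a := Real.sqrt |2 * c + 2 * K|
  set b := Real.sqrt |2 * c + K|
  have ha2 : a ^ 2 = -(2 * c + 2 * K) := by
    rw [Real.sq_sqrt (abs_nonneg _), abs_of_nonpos (by linarith)]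
  have hb2 : b ^ 2 = -(2 * c + K) := by
    rw [Real.sq_sqrt (abs_nonneg _), abs_of_nonpos (by linarith)]
  have hb : 0 < b := Real.sqrt_pos.2 (abs_pos.2 (by
    intro h
    linarith))
  have ha0 : 0 ≤ a := Real.sqrt_nonneg _
  have hdiv : Real.sqrt ((2 * c + 2 * K) / (2 * c + K)) = a / b := by
    rw [← neg_div_neg_eq, ← ha2, ← hb2, ← div_pow, Real.sqrt_sq (by positivity)]
  have hab : b < a := by nlinarith
  have hab2 : a ≤ 2 * b := by nlinarith
  have ha : 0 < a := hb.trans hab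
  rw [hdiv]
  have hcv : c = a ^ 2 / 2 - b ^ 2 := by linarith
  have hKv : -K - c = a ^ 2 / 2 := by linarith
  refine ⟨sub_pos.2 ((one_lt_div hb).2 hab), ?_, ?_⟩
  · rw [sub_le_iff_le_add, div_le_iff₀ hb]
    linarith
  · rw [hKv, hcv, add_sub_cancel]
    field_simp
    ring

theorem re_le_supportFun (A : X →L[ℂ] X) (θ : ℝ) {u : X} (hu : ‖u‖ = 1) {ℓ : StrongDual ℂ X}
    (hℓ : ℓ ∈ supportFunctionals u) :
    (Complex.exp (-(Complex.I * θ)) * ℓ (A u)).re ≤ supportFun A θ := by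
  refine le_csSup ⟨‖A‖, ?_⟩ ⟨_, ⟨u, by simpa using hu, ℓ, hℓ, rfl⟩, rfl⟩
  rintro _ ⟨_, ⟨x, hx, ℓ, hℓ, rfl⟩, rfl⟩
  have hx1 : ‖x‖ = 1 := by simpa using hx
  refine (Complex.re_le_norm _).trans ?_
  have he : ‖Complex.exp (-(Complex.I * θ))‖ = 1 := by
    rw [mul_comm, ← neg_mul, ← Complex.ofReal_neg, Complex.norm_exp_ofReal_mul_I]
  rw [norm_mul, he, one_mul]
  have h1 := norm_apply_le_of_mem_supportFunctionals hℓ (A x)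
  have h2 := A.le_opNorm x
  rw [hx1] at h1 h2
  linarith

/-- Solvability of `f x = w` under a lower bound for the numerical range of `f`. -/
theorem exists_unique_solution [CompleteSpace X] {f : X → X} {c m R : ℝ} (hc : 0 ≤ c)
    (hf : DifferentiableOn ℂ f (ball 0 1)) (h0 : f 0 = 0)
    (hpos : ∀ x ∈ ball (0 : X) 1, ∀ ℓ ∈ supportFunctionals x, c * ‖x‖ ^ 2 ≤ (ℓ (f x)).re)
    (hm : ∀ u : X, ‖u‖ = 1 → ∀ ℓ ∈ supportFunctionals u, m ≤ (ℓ (fderiv ℂ f 0 u)).re)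
    (hR0 : 0 < R) (hR1 : R ≤ 1) {w : X}
    (hw : ‖w‖ < c * R + (m - c) * (R * ((1 - R) / (1 + R)))) :
    ∃ x ∈ ball (0 : X) R, f x = w ∧ IsUnit (fderiv ℂ f x) ∧
      ∀ y ∈ ball (0 : X) R, f y = w → y = x := by
  set φ : ℝ → ℝ := fun r => c * r + (m - c) * (r * ((1 - r) / (1 + r)))
  obtain ⟨ε, hε, hφε⟩ : ∃ ε, 0 < ε ∧ ‖w‖ + ε < φ R :=
    ⟨(φ R - ‖w‖) / 2, by linarith, by linarith⟩
  have hφc : ContinuousAt φ R := by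
    have : 1 + R ≠ 0 := by positivity
    fun_prop (disch := assumption)
  obtain ⟨δ, hδ, hφ⟩ := Metric.eventually_nhds_iff_ball.1
    (hφc.eventually_const_lt hφε)
  obtain ⟨R₀, hR₀, hR₀R, hδR⟩ : ∃ R₀, 0 < R₀ ∧ R₀ < R ∧ R - R₀ < δ :=
    ⟨max (R / 2) (R - δ / 2), lt_max_of_lt_left (by linarith), max_lt (by linarith) (by linarith),
      by linarith [le_max_right (R / 2) (R - δ / 2)]⟩
  have hshell : ∀ x : X, R₀ ≤ ‖x‖ → ‖x‖ < R → ∀ ℓ ∈ supportFunctionals x,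
      ε * ‖x‖ ≤ (ℓ (f x - w)).re := fun x h1 h2 ℓ hℓ => by
    have h3 := re_apply_ge_of_numericalRange hf h0 hpos hm
      (mem_ball_zero_iff.2 (h2.trans_le hR1)) hℓ
    have h4 := re_apply_le_of_mem_supportFunctionals hℓ w
    have h5 : ‖w‖ + ε < φ ‖x‖ := hφ _ (by
      rw [mem_ball, Real.dist_eq, abs_lt]
      constructor <;> linarith)
    have h6 : ‖x‖ ^ 2 * (c + (m - c) * ((1 - ‖x‖) / (1 + ‖x‖))) = ‖x‖ * φ ‖x‖ := by
      simp only [φ]; ring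
    have h7 := mul_le_mul_of_nonneg_left h5.le (norm_nonneg x)
    rw [map_sub, Complex.sub_re]
    linarith
  obtain ⟨r, hr0, hrR⟩ := exists_between hR₀R
  obtain ⟨r₁, hr1, hr1R⟩ := exists_between hrR
  obtain ⟨M, hM⟩ := exists_bound_of_accretive hc hf h0 hpos (by linarith : 0 < r₁)
    (hr1R.trans_le hR1)
  have hsub : ball (0 : X) r₁ ⊆ ball 0 1 := ball_subset_ball (by linarith)
  obtain ⟨x, hx, hFx, hunit, huniq⟩ := exists_unique_zero (F := fun x => f x - w) hR₀.le hr0 hr1 hε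
    ((hf.mono hsub).sub_const w) (M := M + ‖w‖)
    (fun x hx => (norm_sub_le _ _).trans (by gcongr; exact hM x hx))
    fun x h1 h2 => hshell x h1 (h2.trans hr1R)
  refine ⟨x, ball_subset_ball hrR.le hx, sub_eq_zero.1 hFx, ?_, fun y hy hfy => ?_⟩
  · rwa [fderiv_sub_const] at hunit
  -- A solution with `r ≤ ‖y‖ < R` would lie in the shell, where `f - w` points strictly outwards
  -- and cannot vanish.
  · refine huniq y ?_ (sub_eq_zero.2 hfy)
    rw [mem_ball_zero_iff] at hy ⊢
    by_contra hcon
    push Not at hcon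
    obtain ⟨ℓ, hℓ⟩ := supportFunctionals_nonempty y
    have := hshell y (by linarith) hy ℓ hℓ
    rw [hfy, sub_self, map_zero, Complex.zero_re] at this
    have h1 : 0 < ε * ‖y‖ := mul_pos hε (by linarith)
    linarith

/-- A section of a holomorphic map with invertible derivatives that picks the only preimage in an
open set is biholomorphic onto its image. -/
theorem isBiholomorphicInto_of_unique_preimage [CompleteSpace X] {h g : X → X} {D D₁ : Set X}
    (hD : IsOpen D) (hD₁ : IsOpen D₁) (hh : DifferentiableOn ℂ h D₁)
    (hgm : MapsTo g D D₁) (hgh : ∀ y ∈ D, h (g y) = y)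
    (hunit : ∀ y ∈ D, IsUnit (fderiv ℂ h (g y)))
    (huniq : ∀ y ∈ D, ∀ x ∈ D₁, h x = y → x = g y) : IsBiholomorphicInto g D D₁ := by
  have himg : g '' D = D₁ ∩ h ⁻¹' D := by
    ext x
    constructor
    · rintro ⟨y, hy, rfl⟩
      exact ⟨hgm hy, by rw [mem_preimage, hgh y hy]; exact hy⟩
    · rintro ⟨hx, hxD⟩
      exact ⟨h x, hxD, (huniq _ hxD x hx rfl).symm⟩
  refine ⟨fun y hy => ?_, hgm, ?_, h, ?_, hgh⟩
  · obtain ⟨u, hu⟩ := hunit y hy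
    set e := ContinuousLinearEquiv.unitsEquiv ℂ X u
    have he : (e : X →L[ℂ] X) = fderiv ℂ h (g y) := hu
    have hs := hasStrictFDerivAt_of_differentiableOn hD₁ hh (hgm hy)
    rw [← he] at hs
    have hli := hs.to_localInverse
    -- Near `y` the local inverse takes values in `D₁`, so uniqueness of preimages identifies it
    -- with `g`; continuity of `g` is not needed beforehand.
    have hev : ∀ᶠ z in 𝓝 (h (g y)), hs.localInverse h e (g y) z = g z := by
      have h1 : Tendsto (hs.localInverse h e (g y)) (𝓝 (h (g y))) (𝓝 (g y)) :=
        hs.localInverse_tendsto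
      filter_upwards [h1.eventually (hD₁.mem_nhds (hgm hy)), hs.eventually_right_inverse,
        (hgh y hy).symm ▸ hD.mem_nhds hy] with z hz1 hz2 hz3
      exact huniq z hz3 _ hz1 hz2
    have := hli.hasFDerivAt.congr_of_eventuallyEq (hev.mono fun _ h => h.symm)
    rw [hgh y hy] at this
    exact this.differentiableAt.differentiableWithinAt
  · rw [himg]
    exact hh.continuousOn.isOpen_inter_preimage hD₁ hD
  · rw [himg]
    exact hh.mono inter_subset_left

end Inverse

end HolInv

/-! ### The inverse mapping theorem -/

open HolInv in
theorem theorem3p1 {X : Type*} [NormedAddCommGroup X] [NormedSpace ℂ X] [CompleteSpace X]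
    (h : X → X) (hh : DifferentiableOn ℂ h (Metric.ball 0 1)) (h0 : h 0 = 0)
    (θ c : ℝ) (hc : 0 ≤ c)
    (hineq : ∀ x ∈ Metric.ball (0 : X) 1, ∀ ℓ ∈ HolInv.supportFunctionals x,
      (ℓ (Complex.exp (-(Complex.I * θ)) • h x)).re ≤ -c * ‖x‖ ^ 2)
    (ρ R : ℝ)
    (hρ : ρ = HolInv.innerRadius c (HolInv.supportFun (fderiv ℂ h 0) θ))
    (hR : R = HolInv.outerRadius c (HolInv.supportFun (fderiv ℂ h 0) θ)) :
    ∃ g : X → X,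
      HolInv.IsBiholomorphicInto g (Metric.ball 0 ρ) (Metric.ball 0 R) ∧
      (∀ y ∈ Metric.ball (0 : X) ρ, h (g y) = y) ∧
      (∀ y ∈ Metric.ball (0 : X) ρ, ∀ x ∈ Metric.ball (0 : X) R, h x = y → x = g y) := by
  set K := supportFun (fderiv ℂ h 0) θ
  -- This removes the degenerate case `c = K = 0`: the ball is empty and any `g` will do.
  rcases le_or_gt ρ 0 with hρ0 | hρ0
  · rw [ball_eq_empty.2 hρ0]
    refine ⟨id, ⟨differentiableOn_empty, mapsTo_empty _ _, by simp, id,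
      by simpa using differentiableOn_empty, fun x hx => hx.elim⟩, by simp, by simp⟩
  obtain ⟨hR0, hR1, hφ⟩ := outerRadius_spec hc (hρ ▸ hρ0)
  rw [← hR] at hR0 hR1 hφ
  rw [← hρ] at hφ
  set E := Complex.exp (-(Complex.I * θ))
  have hE : ‖E‖ = 1 := by
    simp only [E]
    rw [mul_comm, ← neg_mul, ← Complex.ofReal_neg, Complex.norm_exp_ofReal_mul_I]
  have hE0 : -E ≠ 0 := by simp [E, Complex.exp_ne_zero]
  have hfd : ∀ x ∈ ball (0 : X) 1,
      fderiv ℂ (fun x => -E • h x) x = -E • fderiv ℂ h x := fun x hx =>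
    ((hh.differentiableAt (isOpen_ball.mem_nhds hx)).hasFDerivAt.const_smul (-E)).fderiv
  have hsol : ∀ y ∈ ball (0 : X) ρ, ∃ x, x ∈ ball (0 : X) R ∧ h x = y ∧ IsUnit (fderiv ℂ h x) ∧
      ∀ z ∈ ball (0 : X) R, h z = y → z = x := fun y hy => by
    -- The factor `-E` is unimodular, so the rotated right-hand side still has norm less than `ρ`.
    obtain ⟨x, hx, hxy, hunit, huniq⟩ := exists_unique_solution (f := fun x => -E • h x)
      (m := -K) (w := -E • y) hc (hh.const_smul _) (by simp [h0])
      (fun x hx ℓ hℓ => by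
        have := hineq x hx ℓ hℓ
        rw [neg_smul, map_neg, Complex.neg_re]
        linarith)
      (fun u hu ℓ hℓ => by
        have := re_le_supportFun (fderiv ℂ h 0) θ hu hℓ
        rw [hfd 0 (mem_ball_self one_pos), smul_apply, map_smul, smul_eq_mul,
          neg_mul, Complex.neg_re]
        exact neg_le_neg this)
      hR0 hR1 (by
        rw [hφ, norm_smul, norm_neg, hE, one_mul]
        simpa using hy)
    refine ⟨x, hx, (smul_right_injective X hE0) hxy, ?_, fun z hz hzy => huniq z hz (by rw [hzy])⟩
    rw [hfd x (ball_subset_ball hR1 hx)] at hunit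
    have := hunit.smul (Units.mk0 (-E) hE0)⁻¹
    rwa [Units.smul_def, smul_smul, Units.val_inv_eq_inv_val, Units.val_mk0,
      inv_mul_cancel₀ hE0, one_smul] at this
  choose! g hgm hgh hunit huniq using hsol
  exact ⟨g, isBiholomorphicInto_of_unique_preimage isOpen_ball isOpen_ball
    (hh.mono (ball_subset_ball hR1)) hgm hgh hunit huniq, hgh, huniq⟩
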